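/- A function element $(U,f)$ consists of a domain $U\subset\mathbb{C}$ (nonempty, open, connected) and a holomorphic function $f\colon U\to\mathbb{C}$. Two function elements $(U_1,f_1)$, $(U_2,f_2)$ are direct analytic continuations of each other if $U_1\cap U_2\neq\emptyset$ and $f_1=f_2$ on $U_1\cap U_2$; the complete global analytic function $\mathcal{F}$ determined by $(U_0,f_0)$ is the set of all function elements joined to $(U_0,f_0)$ by a finite chain of direct analytic continuations. The (immersed) Riemann surface $\mathcal{S}\subset X\times Y=\mathbb{C}^2$ determined by $(U_0,f_0)$ is the union of the graphs $\{(x,f(x)):x\in U\}$ of all $(U,f)\in\mathcal{F}$, together with all algebraic points of $\mathcal{F}$, that is, the points $(x_0,g(0))$ for which there are $n\ge 1$, $r>0$ and $g$ holomorphic in $|t|<r$ such that for every $t$ with $0<|t|<r$ some $(U,f)\in\mathcal{F}$ satisfies $x_0+t^n\in U$ and $g(s)=f(x_0+s^n)$ for all $s$ near $t$. The surface $\mathcal{S}$ is discrete if for every $x\in X$ the section $\mathcal{A}(x)=\{y\in Y:(x,y)\in\mathcal{S}\}$ is a discrete subset of $Y$ (all its points are isolated in it). It is trivial if it is a plane $\{(x,y):y=ax+b\}$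 with $a,b\in\mathbb{C}$. The isometries of $X\times Y$ are the elements of the group generated by $(x,y)\mapsto(\bar x,\bar y)$, the rotations $(x,y)\mapsto(e^{i\theta}x,e^{i\phi}y)$ with $\theta,\phi\in\mathbb{R}$, and the translations $t(u,v)\colon(x,y)\mapsto(x+u,y+v)$ with $u,v\in\mathbb{C}$; the isometry group of $\mathcal{S}$ consists of the isometries $g$ with $g\mathcal{S}=\mathcal{S}$. The lattice group $\Lambda$ of $\mathcal{S}$ is the group of translations in the isometry group of $\mathcal{S}$, identified with the orbit $\Lambda(0,0)=\{(u,v):t(u,v)\in\Lambda\}\subset\mathbb{C}^2$. Its rank $\mathrm{Rk}(\Lambda)$ is the least cardinality of a set of generators. \textbf{Lemma.} If $\mathcal{S}$ is a discrete, nontrivial Riemann surface, then its lattice group $\Lambda$ is discrete in $X\times Y=\mathbb{C}^2$, and $\mathrm{Rk}(\Lambda)\le 4$. -/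

import Mathlib

open scoped Pointwise Topology

noncomputable section

/-- A function element `(U, f)`: a domain `U ⊆ ℂ` (nonempty, open and connected) together with a
holomorphic function on `U`. The values of `toFun` outside `domain` carry no meaning. -/
structure FunctionElement where
  domain : Set ℂ
  isOpen_domain : IsOpen domain
  isConnected_domain : IsConnected domain
  toFun : ℂ → ℂ
  holomorphic : DifferentiableOn ℂ toFun domain

namespace FunctionElement

/-- `(U₁, f₁)` and `(U₂, f₂)` are direct analytic continuations of each other: `U₁ ∩ U₂ ≠ ∅` and
`f₁ = f₂` on `U₁ ∩ U₂`. -/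
def DirectContinuation (E₁ E₂ : FunctionElement) : Prop :=
  (E₁.domain ∩ E₂.domain).Nonempty ∧ Set.EqOn E₁.toFun E₂.toFun (E₁.domain ∩ E₂.domain)

/-- The complete global analytic function determined by `E₀`: all function elements that are
joined to `E₀` by a finite chain of direct analytic continuations. -/
def completeFunction (E₀ : FunctionElement) : Set FunctionElement :=
  {E | Relation.ReflTransGen DirectContinuation E₀ E}

/-- The graph `{(x, f x) : x ∈ U}` of a function element, a subset of `ℂ² = X × Y`. -/
def graph (E : FunctionElement) : Set (ℂ × ℂ) :=
  {p | p.1 ∈ E.domain ∧ p.2 = E.toFun p.1}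

end FunctionElement

/-- `(x₀, y₀)` is an ordinary or algebraic point of the global analytic function `𝓕`: for some
`n ≥ 1` there is a branch `x = x₀ + tⁿ`, `y = g t` with `g` holomorphic in a disk about `0` and
`g 0 = y₀`, which for `t ≠ 0` runs through function elements of `𝓕`. When `g` is not constant,
`g t - y₀` vanishes at `0` to some finite order `m ≥ 1`, and the branch behaves near `(x₀, y₀)`
like `(y - y₀)ⁿ = c (x - x₀)ᵐ`. -/
def IsAlgebraicPoint (𝓕 : Set FunctionElement) (p : ℂ × ℂ) : Prop :=
  ∃ (n : ℕ) (r : ℝ) (g : ℂ → ℂ), 0 < n ∧ 0 < r ∧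
    DifferentiableOn ℂ g (Metric.ball 0 r) ∧ g 0 = p.2 ∧
    ∀ t ∈ Metric.ball (0 : ℂ) r, t ≠ 0 →
      ∃ E ∈ 𝓕, p.1 + t ^ n ∈ E.domain ∧ ∀ᶠ s in 𝓝 t, g s = E.toFun (p.1 + s ^ n)

/-- The Riemann surface immersed in `ℂ² = X × Y` that is determined by the function element `E₀`:
the union of the graphs of all elements of the complete global analytic function, augmented by
the algebraic points. -/
def surfaceOf (E₀ : FunctionElement) : Set (ℂ × ℂ) :=
  (⋃ E ∈ E₀.completeFunction, E.graph) ∪ {p | IsAlgebraicPoint E₀.completeFunction p}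

/-- `S ⊆ ℂ²` is an (immersed, complete) Riemann surface. -/
def IsRiemannSurface (S : Set (ℂ × ℂ)) : Prop :=
  ∃ E₀ : FunctionElement, S = surfaceOf E₀

/-- The section `𝒜(x) = π_Y (π_X⁻¹ x)` of `S` at `x`. -/
def sectionAt (S : Set (ℂ × ℂ)) (x : ℂ) : Set ℂ :=
  {y | (x, y) ∈ S}

/-- `S` is discrete: every section is a discrete subset of `Y`, i.e. consists of points that are
isolated in it. -/
def IsDiscreteSurface (S : Set (ℂ × ℂ)) : Prop :=
  ∀ x : ℂ, IsDiscrete (sectionAt S x)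

/-- `S` is trivial: it is a plane, the graph of an affine function `x ↦ a x + b`. -/
def IsTrivialSurface (S : Set (ℂ × ℂ)) : Prop :=
  ∃ a b : ℂ, S = {p | p.2 = a * p.1 + b}

/-- The Schwarz reflection `σ : (x, y) ↦ (x̄, ȳ)`. -/
def schwarz : Equiv.Perm (ℂ × ℂ) where
  toFun p := (star p.1, star p.2)
  invFun p := (star p.1, star p.2)
  left_inv p := by simp
  right_inv p := by simp

/-- The rotation `r(θ, φ) : (x, y) ↦ (e^{iθ} x, e^{iφ} y)`. -/
def euclideanRotation (θ φ : ℝ) : Equiv.Perm (ℂ × ℂ) where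
  toFun p := (Complex.exp (θ * Complex.I) * p.1, Complex.exp (φ * Complex.I) * p.2)
  invFun p := (Complex.exp (-(θ * Complex.I)) * p.1, Complex.exp (-(φ * Complex.I)) * p.2)
  left_inv p := by ext1 <;> simp [← mul_assoc, ← Complex.exp_add]
  right_inv p := by ext1 <;> simp [← mul_assoc, ← Complex.exp_add]

/-- The translation `t(u, v) : (x, y) ↦ (x + u, y + v)`, with `w = (u, v)`. -/
def translation (w : ℂ × ℂ) : Equiv.Perm (ℂ × ℂ) where
  toFun p := p + w
  invFun p := p - w
  left_inv p := by simp
  right_inv p := by simp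

/-- The isometries of `X × Y`: the group generated by `σ`, the `r(θ, φ)` and the `t(u, v)`. -/
def isometries : Subgroup (Equiv.Perm (ℂ × ℂ)) :=
  Subgroup.closure
    ({schwarz} ∪ Set.range (fun a : ℝ × ℝ => euclideanRotation a.1 a.2) ∪ Set.range translation)

/-- The (maximal) isometry group of `S`: all isometries `g` of `X × Y` with `g S = S`. -/
def isometryGroup (S : Set (ℂ × ℂ)) : Subgroup (Equiv.Perm (ℂ × ℂ)) :=
  isometries ⊓ MulAction.stabilizer (Equiv.Perm (ℂ × ℂ)) S

theorem translation_zero : translation 0 = 1 := by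
  ext1 p; simp [translation]

theorem translation_add (w z : ℂ × ℂ) : translation (w + z) = translation w * translation z := by
  ext1 p; simp [translation, add_comm, add_left_comm]

theorem translation_neg (w : ℂ × ℂ) : translation (-w) = (translation w)⁻¹ := by
  rw [eq_inv_iff_mul_eq_one, ← translation_add, neg_add_cancel, translation_zero]

/-- The lattice group `Λ` of `S`: the translations in the isometry group of `S`. The translation
`t(u, v)` is identified with the vector `(u, v) = t(u, v) (0, 0)`, so that `Λ` is at the same time
the lattice, i.e. the orbit of the origin. -/
def latticeGroup (S : Set (ℂ × ℂ)) : AddSubgroup (ℂ × ℂ) where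
  carrier := {w | translation w ∈ isometryGroup S}
  zero_mem' := by
    rw [Set.mem_ofPred_eq, translation_zero]; exact one_mem _
  add_mem' := by
    intro w z hw hz
    rw [Set.mem_ofPred_eq, translation_add]; exact mul_mem hw hz
  neg_mem' := by
    intro w hw
    rw [Set.mem_ofPred_eq, translation_neg]; exact inv_mem hw

/-- The rank of a subgroup of `ℂ²`: the least cardinality of a set of generators. -/
def latticeRank (L : AddSubgroup (ℂ × ℂ)) : Cardinal :=
  (AddSubgroup.toIntSubmodule L).spanRank

end

/-! If `Λ` is not discrete, it contains nonzero `(uₙ, vₙ) → 0`. Translating the graph point over `x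
- uₙ` gives a point of the surface over `x` whose height tends to `f x`. Since `f x` is isolated in
its section, `f (x - uₙ) + vₙ = f x` for all large `n`. How large depends on `x`, but Baire's
theorem makes it uniform on an open set. There `f'` is invariant under `uₙ → 0`, so the identity
theorem makes `f'` constant and the surface a plane. The rank bound holds because a discrete
subgroup of a real space of dimension 4 is free of rank at most 4. -/

open Filter Set in
/-- A holomorphic function on a domain that is, at each point, eventually invariant under a null
sequence of nonzero translations of its graph is affine. -/
theorem exists_eqOn_affine_of_eventually_translation_eq {U : Set ℂ} (hU : IsOpen U)
    (hUc : IsConnected U) {f : ℂ → ℂ} (hf : DifferentiableOn ℂ f U) {w : ℕ → ℂ × ℂ}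
    (hw0 : ∀ n, w n ≠ 0) (hw : Tendsto w atTop (𝓝 0))
    (h : ∀ x ∈ U, ∀ᶠ n in atTop, f (x - (w n).1) + (w n).2 = f x) :
    ∃ a b : ℂ, ∀ x ∈ U, f x = a * x + b := by
  obtain ⟨c, hc⟩ := hUc.nonempty
  obtain ⟨R, hR, hball⟩ := Metric.isOpen_iff.1 hU c hc
  set r := R / 2 with hr
  have hr0 : 0 < r := by positivity
  have hsub : ∀ x ∈ Metric.closedBall c r, ∀ u : ℂ, ‖u‖ < r → x - u ∈ U := by
    intro x hx u hu
    apply hball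
    rw [mem_closedBall_iff_norm] at hx
    rw [mem_ball_iff_norm]
    calc ‖x - u - c‖ = ‖(x - c) - u‖ := by ring_nf
      _ ≤ ‖x - c‖ + ‖u‖ := norm_sub_le _ _
      _ < R := by linarith
  have hfst : ∀ n, ‖(w n).1‖ ≤ ‖w n‖ := fun n => norm_fst_le _
  -- Points at which `N` serves as threshold. The bound `‖w n‖ < r` keeps the shifted points in `U`,
  -- where `f` is continuous, so that `C N` is closed.
  let C : ℕ → Set ℂ := fun N => ⋂ n ∈ {n | N ≤ n ∧ ‖w n‖ < r},
    {x ∈ Metric.closedBall c r | f (x - (w n).1) + (w n).2 = f x}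
  have hCclosed : ∀ N, IsClosed (C N) := by
    intro N
    refine isClosed_biInter fun n hn => ?_
    have hshift : ContinuousOn (fun x => f (x - (w n).1)) (Metric.closedBall c r) :=
      hf.continuousOn.comp (by fun_prop) fun x hx => hsub x hx _ ((hfst n).trans_lt hn.2)
    have hself : ContinuousOn f (Metric.closedBall c r) :=
      hf.continuousOn.mono fun x hx => by simpa using hsub x hx 0 (by simpa using hr0)
    exact Metric.isClosed_closedBall.isClosed_eq (hshift.add continuousOn_const) hself
  -- Adding the complement of the ball gives a closed cover of all of `ℂ`, to which Baire applies.
  have hcover : ⋃ N, C N ∪ (Metric.ball c r)ᶜ = univ := by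
    refine eq_univ_of_forall fun x => ?_
    by_cases hx : x ∈ Metric.ball c r
    · have hxU : x ∈ U := hball (Metric.ball_subset_ball (by linarith) hx)
      obtain ⟨N, hN⟩ := eventually_atTop.1 (h x hxU)
      exact mem_iUnion.2 ⟨N, Or.inl (mem_iInter₂.2 fun n hn =>
        ⟨Metric.ball_subset_closedBall hx, hN n hn.1⟩)⟩
    · exact mem_iUnion.2 ⟨0, Or.inr hx⟩
  obtain ⟨z, hzball, hz⟩ := (dense_iUnion_interior_of_closed
    (fun N => (hCclosed N).union Metric.isOpen_ball.isClosed_compl) hcover).inter_open_nonempty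
      (Metric.ball c r) Metric.isOpen_ball ⟨c, Metric.mem_ball_self hr0⟩
  obtain ⟨N, hzN⟩ := mem_iUnion.1 hz
  have hzU : z ∈ U := hball (Metric.ball_subset_ball (by linarith) hzball)
  have hnear : ∀ᶠ x in 𝓝 z, x ∈ C N := by
    filter_upwards [mem_interior_iff_mem_nhds.1 hzN, Metric.isOpen_ball.mem_nhds hzball]
      with x hx hxb
    exact hx.resolve_right (not_not.2 hxb)
  have hlarge : ∀ᶠ n in atTop, N ≤ n ∧ ‖w n‖ < r :=
    (eventually_ge_atTop N).and (hw.norm.eventually_lt_const (by simpa using hr0))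
  have hloc : ∀ᶠ n in atTop, ∀ᶠ x in 𝓝 z, f (x - (w n).1) + (w n).2 = f x := by
    filter_upwards [hlarge] with n hn
    filter_upwards [hnear] with x hx
    exact (mem_iInter₂.1 hx n hn).2
  -- A vanishing first component would force the second to vanish, against `w n ≠ 0`.
  have hfst0 : ∀ᶠ n in atTop, z - (w n).1 ≠ z := by
    filter_upwards [hloc] with n hn hz1
    have h1 : (w n).1 = 0 := by simpa using hz1
    have h2 : (w n).2 = 0 := by simpa [h1] using hn.self_of_nhds
    exact hw0 n (Prod.ext h1 h2)
  have hderiv : ∀ᶠ n in atTop, deriv f (z - (w n).1) = deriv f z := by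
    filter_upwards [hloc] with n hn
    have hn' : (fun x => f (x - (w n).1) + (w n).2) =ᶠ[𝓝 z] f := hn
    rw [← hn'.deriv_eq, deriv_add_const, deriv_comp_sub_const]
  have htend : Tendsto (fun n => z - (w n).1) atTop (𝓝[≠] z) := by
    refine tendsto_nhdsWithin_iff.2 ⟨?_, hfst0⟩
    simpa using (tendsto_const_nhds (x := z)).sub ((continuous_fst.tendsto _).comp hw)
  have hconst : EqOn (deriv f) (fun _ => deriv f z) U :=
    (hf.analyticOnNhd hU).deriv.eqOn_of_preconnected_of_frequently_eq
      (fun _ _ => analyticAt_const) hUc.isPreconnected hzU (htend.frequently hderiv.frequently)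
  obtain ⟨b, hb⟩ := hU.exists_is_const_of_deriv_eq_zero (f := fun x => f x - deriv f z * x)
    hUc.isPreconnected (hf.sub (by fun_prop)) (fun x hx => by
      have hd : HasDerivAt f (deriv f x) x :=
        (hf.differentiableAt (hU.mem_nhds hx)).hasDerivAt
      have := (hd.sub ((hasDerivAt_id x).const_mul (deriv f z))).deriv
      simpa [hconst hx] using! this)
  exact ⟨deriv f z, b, fun x hx => by rw [← hb x hx]; ring⟩

-- An affine function is entire, so the identity theorem carries it across each overlap of the
-- chain.
open Filter Set in
theorem completeFunction_eqOn_affine {E₀ : FunctionElement} {a b : ℂ}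
    (h : ∀ x ∈ E₀.domain, E₀.toFun x = a * x + b) {E : FunctionElement}
    (hE : E ∈ E₀.completeFunction) : ∀ x ∈ E.domain, E.toFun x = a * x + b := by
  induction hE with
  | refl => exact h
  | @tail E₁ E₂ _ h12 ih =>
    obtain ⟨⟨z, hz1, hz2⟩, heq⟩ := h12
    have h1 : AnalyticOnNhd ℂ E₂.toFun E₂.domain :=
      E₂.holomorphic.analyticOnNhd E₂.isOpen_domain
    have h2 : AnalyticOnNhd ℂ (fun x => a * x + b) E₂.domain :=
      DifferentiableOn.analyticOnNhd (by fun_prop) E₂.isOpen_domain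
    refine h1.eqOn_of_preconnected_of_eventuallyEq h2 E₂.isConnected_domain.isPreconnected hz2 ?_
    filter_upwards [E₁.isOpen_domain.mem_nhds hz1, E₂.isOpen_domain.mem_nhds hz2] with x hx1 hx2
    rw [← heq ⟨hx1, hx2⟩, ih x hx1]

open Filter Set in
theorem surfaceOf_eq_of_eqOn_affine {E₀ : FunctionElement} {a b : ℂ}
    (h : ∀ x ∈ E₀.domain, E₀.toFun x = a * x + b) :
    surfaceOf E₀ = {p | p.2 = a * p.1 + b} := by
  apply Subset.antisymm
  · rintro p (hp | ⟨n, r, g, hn, hr, hg, hg0, hbranch⟩)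
    · simp only [mem_iUnion] at hp
      obtain ⟨E, hE, hp1, hp2⟩ := hp
      exact hp2.trans (completeFunction_eqOn_affine h hE _ hp1)
    -- Algebraic points add nothing: the affine relation holds on the punctured disk and passes to
    -- the limit `t → 0`.
    · have hpunct : ∀ᶠ t in 𝓝[≠] (0 : ℂ), g t = a * (p.1 + t ^ n) + b := by
        filter_upwards [self_mem_nhdsWithin,
          nhdsWithin_le_nhds (Metric.ball_mem_nhds (0 : ℂ) hr)] with t ht0 htr
        obtain ⟨E, hE, hdom, hev⟩ := hbranch t htr ht0
        rw [hev.self_of_nhds, completeFunction_eqOn_affine h hE _ hdom]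
      have hlim : Tendsto g (𝓝[≠] 0) (𝓝 (g 0)) :=
        ((hg.differentiableAt (Metric.ball_mem_nhds 0 hr)).continuousAt).tendsto.mono_left
          nhdsWithin_le_nhds
      have hlim' : Tendsto (fun t : ℂ => a * (p.1 + t ^ n) + b) (𝓝[≠] 0)
          (𝓝 (a * (p.1 + 0 ^ n) + b)) :=
        (Continuous.tendsto (by fun_prop) 0).mono_left nhdsWithin_le_nhds
      have := tendsto_nhds_unique hlim (hlim'.congr' (hpunct.mono fun _ ht => ht.symm))
      rw [zero_pow hn.ne', add_zero, hg0] at this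
      exact this
  · intro p hp
    -- The whole plane is the graph of one entire element, a direct continuation of `E₀`.
    let P : FunctionElement :=
      { domain := univ
        isOpen_domain := isOpen_univ
        isConnected_domain := isConnected_univ
        toFun := fun x => a * x + b
        holomorphic := by fun_prop }
    refine Or.inl (mem_biUnion (x := P) (Relation.ReflTransGen.single ⟨?_, ?_⟩) ⟨mem_univ _, hp⟩)
    · simpa [P] using E₀.isConnected_domain.nonempty
    · exact fun x hx => h x hx.1

theorem add_mem_of_mem_latticeGroup {S : Set (ℂ × ℂ)} {w p : ℂ × ℂ} (hw : w ∈ latticeGroup S)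
    (hp : p ∈ S) : p + w ∈ S := by
  have hstab : translation w • S = S := MulAction.mem_stabilizer_iff.1 (Subgroup.mem_inf.1 hw).2
  rw [← hstab]
  exact Set.smul_mem_smul_set hp

/-- A subgroup of `ℂ²` whose nonzero elements stay away from the origin is discrete. -/
theorem isDiscrete_of_forall_norm_ge {L : AddSubgroup (ℂ × ℂ)} {ε : ℝ} (hε : 0 < ε)
    (h : ∀ w ∈ L, w ≠ 0 → ε ≤ ‖w‖) : IsDiscrete (L : Set (ℂ × ℂ)) := by
  refine ⟨?_⟩
  refine discreteTopology_of_isOpen_singleton_zero (G := L) ?_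
  rw [Metric.isOpen_singleton_iff]
  refine ⟨ε, hε, fun y hy => ?_⟩
  by_contra hne
  have := h y y.2 (by simpa using hne)
  rw [dist_zero_right] at hy
  exact absurd hy (not_lt.2 this)

theorem latticeRank_le_four_of_isDiscrete {L : AddSubgroup (ℂ × ℂ)}
    (hL : IsDiscrete (L : Set (ℂ × ℂ))) : latticeRank L ≤ 4 := by
  have hdt : DiscreteTopology L.toIntSubmodule := hL.to_subtype
  have hspan : Submodule.span ℤ (L : Set (ℂ × ℂ)) = L.toIntSubmodule :=
    Submodule.span_eq L.toIntSubmodule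
  have hrank : Module.finrank ℤ L.toIntSubmodule ≤ 4 := by
    have heq := Real.finrank_eq_int_finrank_of_discrete (s := (L : Set (ℂ × ℂ))) (hspan ▸ hdt)
    rw [Set.finrank, Set.finrank, hspan] at heq
    rw [← heq]
    refine (Submodule.finrank_le _).trans ?_
    rw [Module.finrank_prod, Complex.finrank_real_complex]
  -- The lattice is free over `ℤ`, so its least number of generators is its rank.
  rw [latticeRank, ← Submodule.spanRank_top, ← Submodule.rank_eq_spanRank_of_free,
    ← Module.finrank_eq_rank]
  exact_mod_cast hrank

theorem mainTheorem9 (S : Set (ℂ × ℂ)) (hS : IsRiemannSurface S) (hdisc : IsDiscreteSurface S)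
    (hnontriv : ¬ IsTrivialSurface S) :
    IsDiscrete (latticeGroup S : Set (ℂ × ℂ)) ∧ latticeRank (latticeGroup S) ≤ 4 := by
  suffices h : IsDiscrete (latticeGroup S : Set (ℂ × ℂ)) from
    ⟨h, latticeRank_le_four_of_isDiscrete h⟩
  by_contra hnd
  have hsmall : ∀ n : ℕ, ∃ w ∈ latticeGroup S, w ≠ 0 ∧ ‖w‖ < 1 / ((n : ℝ) + 1) := by
    intro n
    by_contra! hcon
    exact hnd (isDiscrete_of_forall_norm_ge (by positivity) hcon)
  choose w hwL hw0 hwn using hsmall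
  have hw : Filter.Tendsto w Filter.atTop (𝓝 0) :=
    squeeze_zero_norm (fun n => (hwn n).le) tendsto_one_div_add_atTop_nhds_zero_nat
  obtain ⟨E₀, rfl⟩ := hS
  have hinv : ∀ x ∈ E₀.domain, ∀ᶠ n in Filter.atTop,
      E₀.toFun (x - (w n).1) + (w n).2 = E₀.toFun x := by
    intro x hx
    have hgraph : ∀ y ∈ E₀.domain, (y, E₀.toFun y) ∈ surfaceOf E₀ := fun y hy =>
      Or.inl (Set.mem_biUnion (x := E₀) Relation.ReflTransGen.refl ⟨hy, rfl⟩)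
    have hsub : Filter.Tendsto (fun n => x - (w n).1) Filter.atTop (𝓝 x) := by
      simpa using (tendsto_const_nhds (x := x)).sub ((continuous_fst.tendsto _).comp hw)
    have hcont : ContinuousAt E₀.toFun x :=
      (E₀.holomorphic.differentiableAt (E₀.isOpen_domain.mem_nhds hx)).continuousAt
    have hval : Filter.Tendsto (fun n => E₀.toFun (x - (w n).1) + (w n).2) Filter.atTop
        (𝓝 (E₀.toFun x)) := by
      simpa using (hcont.tendsto.comp hsub).add ((continuous_snd.tendsto _).comp hw)
    obtain ⟨ε, hε, hiso⟩ := Metric.exists_ball_inter_eq_singleton_of_mem_discrete (hdisc x)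
      (x := E₀.toFun x) (hgraph x hx)
    filter_upwards [hval (Metric.ball_mem_nhds _ hε), hsub (E₀.isOpen_domain.mem_nhds hx)]
      with n hn hdom
    -- Translation by `w n` moves the graph point over `x - (w n).1` into the fibre over `x`.
    have hmem : E₀.toFun (x - (w n).1) + (w n).2 ∈ sectionAt (surfaceOf E₀) x := by
      have := add_mem_of_mem_latticeGroup (hwL n) (hgraph _ hdom)
      simpa [sectionAt, Prod.add_def] using this
    have := hiso.subset ⟨hn, hmem⟩
    exact this
  obtain ⟨a, b, hab⟩ := exists_eqOn_affine_of_eventually_translation_eq E₀.isOpen_domain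
    E₀.isConnected_domain E₀.holomorphic hw0 hw hinv
  exact hnontriv ⟨a, b, surfaceOf_eq_of_eqOn_affine hab⟩
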